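/- Let $k$ be an algebraically closed field of characteristic different from $2$, let $V$ be a nonzero finite-dimensional vector space over $k$, and let $G=\mathrm{GL}(V)$. Identify $V^*\otimes V^*\otimes V$ with the space of bilinear maps $m\colon V\times V\to V$, on which $G$ acts by $(g\cdot m)(a,b)=g\bigl(m(g^{-1}a,g^{-1}b)\bigr)$, and let $\mathcal C$ be the linear subspace of symmetric bilinear maps. For $m\in\mathcal C$, let $\{V,m\}$ be the (not necessarily associative) $k$-algebra with underlying space $V$ and product $ab:=m(a,b)$. Then for points $m$ in general position in $\mathcal C$, that is, for all $m$ in some Zariski-open Zariski-dense subset of $\mathcal C$, the algebra $\{V,m\}$ is a simple commutative algebra (its product is not identically zero, and its only two-sided ideals are $0$ and $V$), and its automorphism group, which is the stabilizer of $m$ in $G$, is trivial. -/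

import Mathlib

namespace GenericAlgebra

universe u v

section Zariski

/-- The algebra `k[W]` of polynomial functions on a vector space `W`: the subalgebra of the
algebra of all functions `W → k` that is generated by the linear functions. -/
def polyFun (k : Type u) (W : Type v) [Field k] [AddCommGroup W] [Module k W] :
    Subalgebra k (W → k) :=
  Algebra.adjoin k (Set.range fun l : Module.Dual k W => (l : W → k))

/-- The set of common zeros of a set of functions. -/
def zeroSet {k : Type u} {W : Type v} [Field k] (S : Set (W → k)) : Set W :=
  {w | ∀ f ∈ S, f w = 0}

/-- The Zariski topology on a vector space `W`: the closed sets are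
the sets of common zeros of sets of polynomial functions. -/
@[reducible] def zariski (k : Type u) (W : Type v) [Field k] [AddCommGroup W] [Module k W] :
    TopologicalSpace W :=
  TopologicalSpace.ofClosed {Z | ∃ S : Set (W → k), S ⊆ polyFun k W ∧ Z = zeroSet S}
    ⟨{1}, Set.singleton_subset_iff.2 (one_mem (polyFun k W)), by
      ext w; simp [zeroSet]⟩
    (by
      intro A hA
      refine ⟨{f | f ∈ polyFun k W ∧ ∃ Z ∈ A, ∀ w ∈ Z, f w = 0}, fun f hf => hf.1, ?_⟩
      ext w
      constructor
      · rintro hw f ⟨-, Z, hZ, hf⟩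
        exact hf w (hw Z hZ)
      · intro hw Z hZ
        obtain ⟨S, hS, rfl⟩ := hA hZ
        intro f hf
        exact hw f ⟨hS hf, _, hZ, fun x hx => hx f hf⟩)
    (by
      rintro _ ⟨S, hS, rfl⟩ _ ⟨T, hT, rfl⟩
      refine ⟨{h | ∃ f ∈ S, ∃ g ∈ T, h = f * g}, ?_, ?_⟩
      · rintro _ ⟨f, hf, g, hg, rfl⟩
        exact mul_mem (hS hf) (hT hg)
      · ext w
        constructor
        · rintro (hw | hw) _ ⟨f, hf, g, hg, rfl⟩
          · simp [hw f hf]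
          · simp [hw g hg]
        · intro hw
          by_contra hcon
          simp only [Set.mem_union, not_or, zeroSet, Set.mem_ofPred_eq, not_forall] at hcon
          obtain ⟨⟨f, hf, hfw⟩, g, hg, hgw⟩ := hcon
          exact mul_ne_zero hfw hgw (hw (f * g) ⟨f, hf, g, hg, rfl⟩))

/-- A property holds for points in general position in `W` if it holds for all points of
some Zariski open and Zariski dense subset of `W`. -/
def InGeneralPosition (k : Type u) {W : Type v} [Field k] [AddCommGroup W] [Module k W]
    (P : W → Prop) : Prop :=
  ∃ U : Set W, @IsOpen W (zariski k W) U ∧ @Dense W (zariski k W) U ∧ ∀ w ∈ U, P w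

end Zariski

section Multiplications

/-- The space `V* ⊗ V* ⊗ V` of multiplications on `V`, identified with the space of bilinear maps
`V × V → V`. The product of `a` and `b` in the algebra `{V, m}` is `m a b`. -/
abbrev Multiplication (k : Type u) (V : Type v) [Field k] [AddCommGroup V] [Module k V] :=
  V →ₗ[k] V →ₗ[k] V

variable {k : Type u} {V : Type v} [Field k] [AddCommGroup V] [Module k V]

variable (k V) in
/-- The space of commutative multiplications: those fixed by the involution
that interchanges the two arguments. -/
def commMultiplications : Submodule k (Multiplication k V) where
  carrier := {m | m.flip = m}
  add_mem' := by
    intro a b ha hb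
    ext x y
    have h1 := LinearMap.congr_fun₂ ha x y
    have h2 := LinearMap.congr_fun₂ hb x y
    simp only [LinearMap.flip_apply] at h1 h2
    simp [h1, h2]
  zero_mem' := by ext; simp
  smul_mem' := by
    intro c a ha
    ext x y
    have h1 := LinearMap.congr_fun₂ ha x y
    simp only [LinearMap.flip_apply] at h1
    simp [h1]

/-- `{V, m}` is commutative. -/
def IsCommutativeAlg (m : Multiplication k V) : Prop := ∀ a b : V, m a b = m b a

/-- `I` is a two-sided ideal of the algebra `{V, m}`. -/
def IsTwoSidedIdeal (m : Multiplication k V) (I : Submodule k V) : Prop :=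
  ∀ a : V, ∀ x ∈ I, m a x ∈ I ∧ m x a ∈ I

/-- `{V, m}` is a simple algebra: its product is not identically zero and it has no
two-sided ideals other than zero and the whole algebra. -/
def IsSimpleAlg (m : Multiplication k V) : Prop :=
  m ≠ 0 ∧ ∀ I : Submodule k V, IsTwoSidedIdeal m I → I = ⊥ ∨ I = ⊤

/-- The automorphism group of the algebra `{V, m}`, as a subgroup of `GL(V)`. -/
def autGroup (m : Multiplication k V) : Subgroup (V ≃ₗ[k] V) where
  carrier := {g | ∀ a b : V, g (m a b) = m (g a) (g b)}
  mul_mem' := by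
    intro g h hg hh a b
    simp only [LinearEquiv.mul_apply]
    rw [hh, hg]
  one_mem' := fun _ _ => rfl
  inv_mem' := by
    intro g hg a b
    apply g.injective
    change g (g.symm _) = g (m (g.symm a) (g.symm b))
    rw [hg]
    simp

/-- The action of `GL(V)` on multiplications: `(g · m)(a, b) = g (m (g⁻¹ a, g⁻¹ b))`. -/
def act (g : V ≃ₗ[k] V) (m : Multiplication k V) : Multiplication k V :=
  (m.compl₁₂ (g.symm : V →ₗ[k] V) (g.symm : V →ₗ[k] V)).compr₂ (g : V →ₗ[k] V)

theorem act_apply (g : V ≃ₗ[k] V) (m : Multiplication k V) (a b : V) :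
    act g m a b = g (m (g.symm a) (g.symm b)) := rfl

/-- The stabilizer of a multiplication in `GL(V)`. -/
def stabilizer (m : Multiplication k V) : Subgroup (V ≃ₗ[k] V) where
  carrier := {g | act g m = m}
  mul_mem' := by
    intro g h hg hh
    change act (g * h) m = m
    have : act (g * h) m = act g (act h m) := rfl
    rw [this, hh, hg]
  one_mem' := rfl
  inv_mem' := by
    intro g hg
    change act g⁻¹ m = m
    have hg' : act g m = m := hg
    have : act g⁻¹ (act g m) = m := by
      ext a b
      change g.symm (g (m (g.symm (g a)) (g.symm (g b)))) = m a b
      simp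
    rwa [hg'] at this

end Multiplications

end GenericAlgebra

/-! Write L_x for multiplication by x. The polynomial `rigidityDisc` in the structure constants has
three factors. Their nonvanishing says that the trace form tr(L_x L_y) is nondegenerate, that the
vector u representing x ↦ tr L_x up to scale is cyclic for L_u, and that the products L_i L_j of
basis multiplications span End V. An automorphism conjugates the L_x, so it preserves the trace
form, fixes u and therefore the basis of iterates of u, and is the identity
(`autGroup_eq_bot_of_det_ne_zero`). An ideal is stable under every L_i L_j, hence under End V, so it
is 0 or V (`isSimpleAlg_of_det_productMatrix_ne_zero`). Polynomial functions over an infinite field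
form a domain, so each factor may be tested on an algebra of its own choice
(`rigidityDisc_ne_zero`). -/

namespace GenericAlgebra

/-! ### Polynomial functions and Zariski density. -/

section PolynomialFunctions

variable {k : Type*} {W : Type*} [Field k] [AddCommGroup W] [Module k W]

/-- A polynomial function restricted to a line is given by a polynomial in one variable. -/
theorem exists_polynomial_eval_line {f : W → k} (hf : f ∈ polyFun k W) (a v : W) :
    ∃ p : Polynomial k, ∀ t : k, p.eval t = f (a + t • v) := by
  induction hf using Algebra.adjoin_induction with
  | mem f hf =>
    obtain ⟨l, rfl⟩ := hf
    exact ⟨Polynomial.C (l a) + Polynomial.C (l v) * Polynomial.X, fun t => by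
      simp [mul_comm (l v) t]⟩
  | algebraMap r => exact ⟨Polynomial.C r, fun t => by simp⟩
  | add f g _ _ hf hg =>
    obtain ⟨p, hp⟩ := hf
    obtain ⟨q, hq⟩ := hg
    exact ⟨p + q, fun t => by simp [hp, hq]⟩
  | mul f g _ _ hf hg =>
    obtain ⟨p, hp⟩ := hf
    obtain ⟨q, hq⟩ := hg
    exact ⟨p * q, fun t => by simp [hp, hq]⟩

/-- Over an infinite field, the product of two nonzero polynomial functions is nonzero. -/
instance noZeroDivisors_polyFun [Infinite k] : NoZeroDivisors (polyFun k W) where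
  eq_zero_or_eq_zero_of_mul_eq_zero := by
    rintro ⟨f, hf⟩ ⟨g, hg⟩ h
    have hfg : ∀ w, f w * g w = 0 := fun w => congrFun (congrArg Subtype.val h) w
    by_contra! hne
    have hf0 : ∃ a, f a ≠ 0 := by
      by_contra! h0
      exact hne.1 (Subtype.ext (funext h0))
    have hg0 : ∃ c, g c ≠ 0 := by
      by_contra! h0
      exact hne.2 (Subtype.ext (funext h0))
    obtain ⟨a, ha⟩ := hf0
    obtain ⟨c, hc⟩ := hg0
    -- On the line through `a` and `c`, parameter 0 gives `a` and parameter 1 gives `c`, so neither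
    -- restriction vanishes.
    obtain ⟨p, hp⟩ := exists_polynomial_eval_line hf a (c - a)
    obtain ⟨q, hq⟩ := exists_polynomial_eval_line hg a (c - a)
    have hpq : p * q = 0 := Polynomial.funext fun t => by simp [hp, hq, hfg]
    rcases mul_eq_zero.1 hpq with h0 | h0
    · exact ha (by simpa [h0] using (hp 0).symm)
    · exact hc (by simpa [h0] using (hq 1).symm)

/-- A property that holds wherever a fixed nonzero polynomial function does not vanish holds
in general position. -/
theorem inGeneralPosition_of_ne_zero [Infinite k] {P : W → Prop} (F : polyFun k W) (hF : F ≠ 0)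
    (h : ∀ w, (F : W → k) w ≠ 0 → P w) : InGeneralPosition k P := by
  refine ⟨{w | (F : W → k) w ≠ 0}, ?_, ?_, h⟩
  · refine ⟨{(F : W → k)}, Set.singleton_subset_iff.2 F.2, ?_⟩
    ext w
    simp [zeroSet]
  · refine (@dense_iff_inter_open W (zariski k W) _).2 ?_
    rintro U ⟨S, hS, hU⟩ ⟨w, hw⟩
    have hw' : w ∉ zeroSet S := by
      rw [← hU]
      exact fun h => h hw
    simp only [zeroSet, Set.mem_ofPred_eq, not_forall] at hw'
    obtain ⟨g, hgS, hgw⟩ := hw'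
    have hg : (⟨g, hS hgS⟩ : polyFun k W) ≠ 0 := fun h0 =>
      hgw (congrFun (congrArg Subtype.val h0) w)
    -- `U` contains the nonvanishing locus of `g`, so a point where `g * F` is nonzero lies in both
    -- open sets.
    obtain ⟨x, hx⟩ : ∃ x, g x * (F : W → k) x ≠ 0 := by
      by_contra! h0
      exact mul_ne_zero hg hF (Subtype.ext (funext h0))
    refine ⟨x, ?_, right_ne_zero_of_mul hx⟩
    by_contra hxU
    have hxS : x ∈ zeroSet S := by
      rw [← hU]
      exact hxU
    exact left_ne_zero_of_mul hx (hxS g hgS)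

variable (k) in
/-- Evaluation of polynomial functions at a point. -/
def evalAt (w : W) : polyFun k W →+* k :=
  (Pi.evalRingHom (fun _ : W => k) w).comp (polyFun k W).val.toRingHom

theorem evalAt_apply (w : W) (F : polyFun k W) : evalAt k w F = (F : W → k) w := rfl

end PolynomialFunctions

/-! ### The three determinants over a commutative ring. -/

section StructureConstants

open Matrix

variable {n : ℕ} {S T : Type*} [CommRing S] [CommRing T]

/-- The Gram matrix of the trace form `(x, y) ↦ tr (L x * L y)`, where `L` is given on the basis
by the matrices `c i`. -/
def traceGram (c : Fin n → Matrix (Fin n) (Fin n) S) : Matrix (Fin n) (Fin n) S :=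
  Matrix.of fun i j => (c i * c j).trace

/-- The coordinates of the vector that represents the linear form `x ↦ tr (L x)` with respect to
the trace form, multiplied by the discriminant of the trace form. -/
def traceVec (c : Fin n → Matrix (Fin n) (Fin n) S) : Fin n → S :=
  -- The adjugate, unlike the inverse, keeps the coordinates polynomial in the structure constants.
  (traceGram c).adjugate *ᵥ fun i => (c i).trace

/-- The multiplication by `traceVec c`, minus the identity. -/
def traceOp (c : Fin n → Matrix (Fin n) (Fin n) S) : Matrix (Fin n) (Fin n) S :=
  ∑ i, traceVec c i • c i - 1

/-- The matrix whose columns are the iterates of `traceOp c` on `traceVec c`, in descending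
order. -/
def cyclicMatrix (c : Fin n → Matrix (Fin n) (Fin n) S) : Matrix (Fin n) (Fin n) S :=
  Matrix.of fun p j => (traceOp c ^ (j.rev : ℕ) *ᵥ traceVec c) p

/-- The matrix whose rows are the entries of the products `c i * c j`. -/
def productMatrix (c : Fin n → Matrix (Fin n) (Fin n) S) :
    Matrix (Fin n × Fin n) (Fin n × Fin n) S :=
  Matrix.of fun ij pq => (c ij.1 * c ij.2) pq.1 pq.2

/-- The polynomial in the structure constants whose nonvanishing forces an algebra to be simple
and to have no nontrivial automorphisms. -/
def rigidityDisc (c : Fin n → Matrix (Fin n) (Fin n) S) : S :=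
  (traceGram c).det * (cyclicMatrix c).det * (productMatrix c).det

/-! ### Compatibility with ring homomorphisms, used to specialize generic constants. -/

variable (φ : S →+* T) (c : Fin n → Matrix (Fin n) (Fin n) S)

theorem traceGram_map : traceGram (fun i => (c i).map φ) = (traceGram c).map φ := by
  ext i j
  simp [traceGram, Matrix.trace, Matrix.mul_apply]

theorem traceVec_map : traceVec (fun i => (c i).map φ) = φ ∘ traceVec c := by
  funext i
  have h : (fun i => ((c i).map φ).trace) = φ ∘ fun i => (c i).trace := by
    funext i
    simp [Matrix.trace]
  simp only [traceVec, traceGram_map, Function.comp_apply, RingHom.map_mulVec, h]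
  rw [← RingHom.mapMatrix_apply, ← RingHom.mapMatrix_apply, RingHom.map_adjugate]

theorem traceOp_map : traceOp (fun i => (c i).map φ) = φ.mapMatrix (traceOp c) := by
  simp only [traceOp, traceVec_map, map_sub, map_sum, map_one]
  congr 1
  refine Finset.sum_congr rfl fun i _ => ?_
  ext p q
  simp

theorem cyclicMatrix_map : cyclicMatrix (fun i => (c i).map φ) = φ.mapMatrix (cyclicMatrix c) := by
  ext p j
  simp only [cyclicMatrix, traceOp_map, traceVec_map, ← map_pow, Matrix.of_apply]
  exact (RingHom.map_mulVec φ _ _ p).symm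

theorem productMatrix_map :
    productMatrix (fun i => (c i).map φ) = φ.mapMatrix (productMatrix c) := by
  ext p j
  simp only [productMatrix, ← Matrix.map_mul, Matrix.of_apply,
    RingHom.mapMatrix_apply, Matrix.map_apply]

/-! ### Evolution algebras as test points. -/

/-- The structure constants of the algebra in which distinct basis vectors multiply to zero and
the squares of the basis vectors are the columns of `A`. -/
def evolutionConstants (A : Matrix (Fin n) (Fin n) S) (i : Fin n) : Matrix (Fin n) (Fin n) S :=
  Matrix.of fun p q => if i = q then A p i else 0

theorem evolutionConstants_mul_apply (A : Matrix (Fin n) (Fin n) S) (i j p q : Fin n) :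
    (evolutionConstants A i * evolutionConstants A j) p q =
      if j = q then A p i * A i j else 0 := by
  simp [evolutionConstants, Matrix.mul_apply]

theorem det_productMatrix_evolutionConstants (A : Matrix (Fin n) (Fin n) S) :
    (productMatrix (evolutionConstants A)).det =
      (∏ ij : Fin n × Fin n, A ij.1 ij.2) * A.det ^ n := by
  have h : productMatrix (evolutionConstants A) =
      Matrix.diagonal (fun ij : Fin n × Fin n => A ij.1 ij.2) *
        Matrix.kroneckerMap (· * ·) Aᵀ (1 : Matrix (Fin n) (Fin n) S) := by
    ext ⟨i, j⟩ ⟨p, q⟩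
    simp [productMatrix, evolutionConstants_mul_apply, Matrix.diagonal_mul, Matrix.one_apply,
      mul_comm]
  rw [h, Matrix.det_mul, Matrix.det_diagonal, Matrix.det_kronecker]
  simp

/-- The upper bidiagonal matrix with ones on and directly above the diagonal. -/
def bidiagonal (n : ℕ) (S : Type*) [CommRing S] : Matrix (Fin n) (Fin n) S :=
  Matrix.of fun p q => if p = q ∨ (p : ℕ) + 1 = q then 1 else 0

/-- The (i, j) entry is `A j i * A i j`, and an upper triangular matrix never has both factors
nonzero off the diagonal. -/
theorem traceGram_bidiagonal : traceGram (evolutionConstants (bidiagonal n S)) = 1 := by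
  ext i j
  have h : ((i = j ∨ (i : ℕ) + 1 = j) ∧ (j = i ∨ (j : ℕ) + 1 = i)) ↔ i = j := by
    simp only [Fin.ext_iff]
    omega
  simp only [traceGram, Matrix.of_apply, Matrix.trace, Matrix.diag_apply,
    evolutionConstants_mul_apply]
  rw [Finset.sum_ite_eq, if_pos (Finset.mem_univ _), Matrix.one_apply]
  simp only [bidiagonal, Matrix.of_apply, mul_ite, mul_one, mul_zero, ← ite_and]
  exact if_congr h rfl rfl

theorem traceVec_bidiagonal : traceVec (evolutionConstants (bidiagonal n S)) = 1 := by
  funext i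
  rw [traceVec, traceGram_bidiagonal, Matrix.adjugate_one, Matrix.one_mulVec]
  simp [Matrix.trace, evolutionConstants, bidiagonal]

/-- Multiplication by the all-ones vector is the bidiagonal matrix itself. Subtracting the identity,
which does not change the span of the iterates, leaves a nilpotent shift. -/
theorem traceOp_bidiagonal : traceOp (evolutionConstants (bidiagonal n S)) =
    Matrix.of fun p q : Fin n => if (p : ℕ) + 1 = q then 1 else 0 := by
  ext p q
  rw [traceOp, traceVec_bidiagonal]
  simp only [Pi.one_apply, one_smul, Matrix.sub_apply, Matrix.sum_apply, evolutionConstants,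
    bidiagonal, Matrix.of_apply, Finset.sum_ite_eq', Finset.mem_univ, if_true, Matrix.one_apply]
  by_cases h : p = q
  · subst h
    simp
  · simp [h]

/-- The r-th shift of the all-ones vector has ones in its first n - r places. Column j uses r = n -
1 - j, so the descending order makes the matrix upper unitriangular. -/
theorem cyclicMatrix_bidiagonal : cyclicMatrix (evolutionConstants (bidiagonal n S)) =
    Matrix.of fun p j => if p ≤ j then 1 else 0 := by
  have key : ∀ (r : ℕ) (p : Fin n),
      ((Matrix.of fun p q : Fin n => if (p : ℕ) + 1 = q then (1 : S) else 0) ^ r *ᵥ 1) p =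
        if (p : ℕ) + r < n then 1 else 0 := by
    intro r
    induction r with
    | zero => intro p; simp
    | succ r ih =>
      intro p
      rw [pow_succ', ← Matrix.mulVec_mulVec]
      simp only [Matrix.mulVec, dotProduct, Matrix.of_apply] at ih ⊢
      simp only [ih, ite_mul, one_mul, zero_mul, ← ite_and]
      by_cases h : (p : ℕ) + 1 < n
      · rw [Finset.sum_eq_single (⟨p + 1, h⟩ : Fin n)]
        · exact if_congr (by simp; omega) rfl rfl
        · intro q _ hq
          rw [if_neg]
          rintro ⟨h1, -⟩
          exact hq (Fin.ext h1.symm)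
        · simp
      · rw [if_neg (by omega)]
        refine Finset.sum_eq_zero fun q _ => if_neg ?_
        have := q.2
        omega
  ext p j
  rw [cyclicMatrix, traceOp_bidiagonal, traceVec_bidiagonal, Matrix.of_apply, Matrix.of_apply, key]
  refine if_congr ?_ rfl rfl
  rw [Fin.val_rev, Fin.le_def]
  omega

theorem det_cyclicMatrix_bidiagonal :
    (cyclicMatrix (evolutionConstants (bidiagonal n S))).det = 1 := by
  rw [cyclicMatrix_bidiagonal, Matrix.det_of_isUpperTriangular]
  · simp
  · intro i j hij
    exact if_neg (not_le.2 hij)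

end StructureConstants

/-! ### Generic structure constants and nonvanishing of the discriminant. -/

section Algebras

open Matrix

variable {k : Type*} {V : Type*} [Field k] [AddCommGroup V] [Module k V] {n : ℕ}
  (b : Module.Basis (Fin n) k V)

/-- The matrices of the multiplications by the basis vectors. -/
noncomputable def structureConstants (m : Multiplication k V) (i : Fin n) :
    Matrix (Fin n) (Fin n) k :=
  LinearMap.toMatrix b b (m (b i))

/-- The structure constants as polynomial functions on the space of commutative
multiplications. -/
noncomputable def genericConstants (i : Fin n) :
    Matrix (Fin n) (Fin n) (polyFun k (commMultiplications k V)) :=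
  Matrix.of fun p q => ⟨fun m => b.repr (m.1 (b i) (b q)) p, Algebra.subset_adjoin
    ⟨b.coord p ∘ₗ LinearMap.applyₗ (b q) ∘ₗ LinearMap.applyₗ (b i) ∘ₗ
      (commMultiplications k V).subtype, rfl⟩⟩

theorem genericConstants_map (m : commMultiplications k V) :
    (fun i => (genericConstants b i).map (evalAt k m)) = structureConstants b m.1 := by
  funext i
  ext p q
  simp [genericConstants, structureConstants, evalAt_apply, LinearMap.toMatrix_apply]

theorem evalAt_det_traceGram (m : commMultiplications k V) :
    evalAt k m (traceGram (genericConstants b)).det =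
      (traceGram (structureConstants b m.1)).det := by
  rw [RingHom.map_det, ← genericConstants_map, traceGram_map, RingHom.mapMatrix_apply]

theorem evalAt_det_cyclicMatrix (m : commMultiplications k V) :
    evalAt k m (cyclicMatrix (genericConstants b)).det =
      (cyclicMatrix (structureConstants b m.1)).det := by
  rw [RingHom.map_det, ← genericConstants_map, cyclicMatrix_map]

theorem evalAt_det_productMatrix (m : commMultiplications k V) :
    evalAt k m (productMatrix (genericConstants b)).det =
      (productMatrix (structureConstants b m.1)).det := by
  rw [RingHom.map_det, ← genericConstants_map, productMatrix_map]

/-- The commutative multiplication for which distinct basis vectors multiply to zero and the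
squares of the basis vectors are given by the columns of `A`. -/
noncomputable def evolution (A : Matrix (Fin n) (Fin n) k) : commMultiplications k V :=
  ⟨∑ i, (b.coord i).smulRight ((b.coord i).smulRight (∑ p, A p i • b p)), by
    change LinearMap.flip _ = _
    ext x y
    simp [LinearMap.sum_apply, smul_smul, mul_comm]⟩

theorem structureConstants_evolution (A : Matrix (Fin n) (Fin n) k) :
    structureConstants b (evolution b A).1 = evolutionConstants A := by
  funext i
  ext p q
  have h : (evolution b A).1 (b i) (b q) = if q = i then ∑ p, A p i • b p else 0 := by
    simp [evolution, LinearMap.sum_apply, Finsupp.single_apply]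
  simp only [structureConstants, LinearMap.toMatrix_apply, h, evolutionConstants, Matrix.of_apply]
  split_ifs with h₁ h₂ h₂
  · simp [Finsupp.single_apply]
  · exact absurd h₁.symm h₂
  · exact absurd h₂.symm h₁
  · simp

theorem rigidityDisc_ne_zero [Infinite k] : rigidityDisc (genericConstants b) ≠ 0 := by
  refine mul_ne_zero (mul_ne_zero ?_ ?_) ?_
  · intro h
    have := evalAt_det_traceGram b (evolution b (bidiagonal n k))
    rw [h, structureConstants_evolution, traceGram_bidiagonal] at this
    simp at this
  · intro h
    have := evalAt_det_cyclicMatrix b (evolution b (bidiagonal n k))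
    rw [h, structureConstants_evolution, det_cyclicMatrix_bidiagonal] at this
    simp at this
  · intro h
    -- The test matrix must be invertible with no zero entry: a Vandermonde matrix with distinct
    -- nonzero nodes.
    have : Infinite {x : k // x ≠ 0} := (Set.finite_singleton (0 : k)).infinite_compl.to_subtype
    let v : Fin n ↪ {x : k // x ≠ 0} :=
      Fin.valEmbedding.trans (Infinite.natEmbedding _)
    have hA : (Matrix.vandermonde fun i => (v i : k)).det ≠ 0 :=
      Matrix.det_vandermonde_ne_zero_iff.2 fun i j hij => v.injective (Subtype.ext hij)
    have := evalAt_det_productMatrix b (evolution b (Matrix.vandermonde fun i => (v i : k)))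
    rw [h, structureConstants_evolution, det_productMatrix_evolutionConstants, map_zero] at this
    refine mul_ne_zero (Finset.prod_ne_zero_iff.2 fun ij _ => ?_) (pow_ne_zero n hA) this.symm
    exact pow_ne_zero _ (v ij.1).2

/-! ### Simplicity and rigidity from the determinants. -/

variable {b} {m : Multiplication k V}

/-- If the products of two multiplications by basis vectors span all endomorphisms, the
algebra is simple. -/
theorem isSimpleAlg_of_det_productMatrix_ne_zero [Nontrivial V]
    (h : (productMatrix (structureConstants b m)).det ≠ 0) : IsSimpleAlg m := by
  have hspan : ∀ f : V →ₗ[k] V, ∃ a : Fin n × Fin n → k,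
      f = ∑ ij, a ij • (m (b ij.1) ∘ₗ m (b ij.2)) := by
    intro f
    let t : Fin n × Fin n → k := fun pq => LinearMap.toMatrix b b f pq.1 pq.2
    refine ⟨t ᵥ* (productMatrix (structureConstants b m))⁻¹, ?_⟩
    set a := t ᵥ* (productMatrix (structureConstants b m))⁻¹ with ha
    have hat : a ᵥ* productMatrix (structureConstants b m) = t := by
      rw [ha, Matrix.vecMul_vecMul, Matrix.nonsing_inv_mul _ (isUnit_iff_ne_zero.2 h),
        Matrix.vecMul_one]
    apply (LinearMap.toMatrix b b).injective
    ext p q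
    have := congrFun hat (p, q)
    simp only [map_sum, map_smul, LinearMap.toMatrix_comp b b b, Matrix.sum_apply,
      Matrix.smul_apply, smul_eq_mul]
    exact this.symm
  have htrans : ∀ x y : V, x ≠ 0 → ∃ f : V →ₗ[k] V, f x = y := by
    intro x y hx
    obtain ⟨i, hi⟩ : ∃ i, b.coord i x ≠ 0 := by
      by_contra! h0
      exact hx (b.forall_coord_eq_zero_iff.1 h0)
    exact ⟨(b.coord i).smulRight ((b.coord i x)⁻¹ • y), by
      rw [LinearMap.smulRight_apply, smul_smul, mul_inv_cancel₀ hi, one_smul]⟩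
  refine ⟨?_, fun I hI => ?_⟩
  · rintro rfl
    obtain ⟨x, hx⟩ := exists_ne (0 : V)
    obtain ⟨a, ha⟩ := hspan LinearMap.id
    exact hx (by simpa using LinearMap.congr_fun ha x)
  · refine or_iff_not_imp_left.2 fun hne => ?_
    obtain ⟨x, hxI, hx⟩ := I.ne_bot_iff.1 hne
    refine eq_top_iff.2 fun y _ => ?_
    obtain ⟨f, rfl⟩ := htrans x y hx
    obtain ⟨a, rfl⟩ := hspan f
    rw [LinearMap.sum_apply]
    exact I.sum_mem fun ij _ => I.smul_mem _ (hI _ _ (hI _ _ hxI).1).1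

/-- If the trace form is nondegenerate and the vector dual to the trace is cyclic for the
multiplication by it, the algebra has no nontrivial automorphisms. -/
theorem autGroup_eq_bot_of_det_ne_zero
    (hB : (traceGram (structureConstants b m)).det ≠ 0)
    (hK : (cyclicMatrix (structureConstants b m)).det ≠ 0) : autGroup m = ⊥ := by
  have hfin : Module.Finite k V := Module.Finite.of_basis b
  set c := structureConstants b m with hc
  let u : V := ∑ i, traceVec c i • b i
  let τ : V → V → k := fun x y => LinearMap.trace k V (m x * m y)
  have hτb : ∀ i j, τ (b i) (b j) = traceGram c i j := fun i j => by
    simp only [τ, traceGram, Matrix.of_apply, hc, structureConstants]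
    rw [LinearMap.trace_eq_matrix_trace k b, LinearMap.toMatrix_mul]
  have hτsum : ∀ (a : Fin n → k) (j : Fin n),
      τ (∑ i, a i • b i) (b j) = (a ᵥ* traceGram c) j := fun a j => by
    simp only [Matrix.vecMul, dotProduct, ← hτb]
    simp [τ, Finset.sum_mul]
  have hsymm : (traceGram c)ᵀ = traceGram c := by
    ext i j
    simp only [traceGram, Matrix.transpose_apply, Matrix.of_apply]
    exact Matrix.trace_mul_comm _ _
  -- The adjugate times the Gram matrix is the determinant, which is the harmless scalar here.
  have hτu : ∀ y, τ u y = (traceGram c).det * LinearMap.trace k V (m y) := by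
    let l₁ : V →ₗ[k] k := LinearMap.trace k V ∘ₗ LinearMap.mulLeft k (m u) ∘ₗ m
    let l₂ : V →ₗ[k] k := (traceGram c).det • (LinearMap.trace k V ∘ₗ m)
    have : l₁ = l₂ := b.ext fun j => by
      change τ u (b j) = (traceGram c).det * LinearMap.trace k V (m (b j))
      rw [hτsum, ← Matrix.mulVec_transpose, hsymm, traceVec, Matrix.mulVec_mulVec,
        Matrix.mul_adjugate, Matrix.smul_mulVec, Matrix.one_mulVec,
        LinearMap.trace_eq_matrix_trace k b]
      rfl
    exact fun y => LinearMap.congr_fun this y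
  have hnondeg : ∀ x, (∀ y, τ x y = 0) → x = 0 := by
    intro x hx
    have h0 : (fun i => b.repr x i) ᵥ* traceGram c = 0 := by
      funext j
      rw [← hτsum, b.sum_repr]
      exact hx _
    have h1 := Matrix.eq_zero_of_vecMul_eq_zero hB h0
    exact b.forall_coord_eq_zero_iff.1 fun i => congrFun h1 i
  refine (Subgroup.eq_bot_iff_forall _).2 fun g hg => ?_
  have hg' : ∀ x y, g (m x y) = m (g x) (g y) := hg
  have hconj : ∀ x, m (g x) = g.conj (m x) := fun x => by
    ext y
    simp [LinearEquiv.conj_apply, hg']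
  have hτg : ∀ x y, τ (g x) (g y) = τ x y := fun x y => by
    simp only [τ, hconj]
    rw [Module.End.mul_eq_comp, ← LinearEquiv.conj_comp, LinearMap.trace_conj']
    rfl
  have hgu : g u = u := by
    -- With y = g z, both pairings equal the determinant times tr L_z, since L_y is conjugate to
    -- L_z.
    refine sub_eq_zero.1 (hnondeg _ fun y => ?_)
    have hsub : τ (g u - u) y = τ (g u) y - τ u y := by
      simp [τ, sub_mul]
    obtain ⟨z, rfl⟩ := g.surjective y
    rw [hsub, hτg, hτu, hτu, hconj, LinearMap.trace_conj', sub_self]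
  have hop : LinearMap.toMatrix b b (m u - 1) = traceOp c := by
    rw [map_sub, LinearMap.toMatrix_one, traceOp]
    simp [u, hc, structureConstants]
  have hgpow : ∀ (r : ℕ), g (((m u - 1) ^ r) u) = ((m u - 1) ^ r) u := by
    intro r
    induction r with
    | zero => simpa using hgu
    | succ r ih =>
      rw [pow_succ', Module.End.mul_apply, LinearMap.sub_apply, map_sub, hg', hgu,
        Module.End.one_apply, ih]
  have hcol : ∀ (j p : Fin n), b.repr (((m u - 1) ^ (j.rev : ℕ)) u) p = cyclicMatrix c p j := by
    intro j p
    have hu : ⇑(b.repr u) = traceVec c := b.repr_sum_self _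
    rw [cyclicMatrix, Matrix.of_apply, ← hop, LinearMap.toMatrix_pow, ← hu,
      LinearMap.toMatrix_mulVec_repr]
  have hP : (LinearMap.toMatrix b b (g : V →ₗ[k] V)) * cyclicMatrix c = cyclicMatrix c := by
    ext p j
    have h1 := congrFun (LinearMap.toMatrix_mulVec_repr b b (g : V →ₗ[k] V)
      (((m u - 1) ^ (j.rev : ℕ)) u)) p
    rw [LinearEquiv.coe_coe, hgpow, hcol] at h1
    rw [← h1]
    simp only [Matrix.mul_apply, Matrix.mulVec, dotProduct, hcol]
  -- The columns of the invertible cyclic matrix are fixed by `g`, so it can be cancelled.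
  have hone : LinearMap.toMatrix b b (g : V →ₗ[k] V) = 1 := by
    have hu : IsUnit (cyclicMatrix c) :=
      (Matrix.isUnit_iff_isUnit_det _).2 (isUnit_iff_ne_zero.2 hK)
    exact hu.mul_right_cancel (by rw [hP, one_mul])
  have hid : (g : V →ₗ[k] V) = LinearMap.id :=
    (LinearMap.toMatrix b b).injective (by rw [hone, LinearMap.toMatrix_id])
  exact LinearEquiv.ext fun x => LinearMap.congr_fun hid x

theorem stabilizer_eq_autGroup (m : Multiplication k V) : stabilizer m = autGroup m := by
  ext g
  change act g m = m ↔ ∀ a b : V, g (m a b) = m (g a) (g b)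
  constructor
  · intro h x y
    have := LinearMap.congr_fun₂ h (g x) (g y)
    simpa [act_apply] using this
  · intro h
    ext x y
    simp [act_apply, h]

end Algebras

end GenericAlgebra

theorem theorem3 {k : Type*} [Field k] [IsAlgClosed k] (hk : ringChar k ≠ 2)
    {V : Type*} [AddCommGroup V] [Module k V] [FiniteDimensional k V] [Nontrivial V] :
    GenericAlgebra.InGeneralPosition k
      (fun m : GenericAlgebra.commMultiplications k V =>
        GenericAlgebra.IsSimpleAlg (m : GenericAlgebra.Multiplication k V) ∧
        GenericAlgebra.IsCommutativeAlg (m : GenericAlgebra.Multiplication k V) ∧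
        GenericAlgebra.autGroup (m : GenericAlgebra.Multiplication k V) = ⊥ ∧
        GenericAlgebra.stabilizer (m : GenericAlgebra.Multiplication k V) = ⊥) := by
  have : Infinite k := IsAlgClosed.instInfinite
  let b := Module.finBasis k V
  refine GenericAlgebra.inGeneralPosition_of_ne_zero _
    (GenericAlgebra.rigidityDisc_ne_zero b) fun m hm => ?_
  rw [← GenericAlgebra.evalAt_apply, GenericAlgebra.rigidityDisc, map_mul, map_mul,
    GenericAlgebra.evalAt_det_traceGram, GenericAlgebra.evalAt_det_cyclicMatrix,
    GenericAlgebra.evalAt_det_productMatrix] at hm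
  have haut := GenericAlgebra.autGroup_eq_bot_of_det_ne_zero
    (left_ne_zero_of_mul (left_ne_zero_of_mul hm)) (right_ne_zero_of_mul (left_ne_zero_of_mul hm))
  refine ⟨GenericAlgebra.isSimpleAlg_of_det_productMatrix_ne_zero (right_ne_zero_of_mul hm),
    fun x y => (LinearMap.congr_fun₂ m.2 x y).symm, haut, ?_⟩
  rw [GenericAlgebra.stabilizer_eq_autGroup, haut]
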